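/- Let $G$ be a simple bipartite graph with at least one edge and with parts $[n]$ and $[m]$, in which every vertex of $[n]$ has degree $d_1$ and every vertex of $[m]$ has degree $d_2$. Let $E\subset[n]\times[m]$ be its edge set, let $\lambda_1\ge\lambda_2\ge\cdots\ge\lambda_{n+m}$ be the eigenvalues of its adjacency matrix, counted with multiplicity, and let $\eta\ge 0$ be a bound for the second eigenvalue, $\lambda_2\le\eta$. For a real $n\times m$ matrix $Y$ let $$\gamma_2(Y)=\min_{UV^*=Y}\ \max_i\|u_i\|_2\,\max_j\|v_j\|_2 ,$$ the minimum being over all real factorizations $Y=UV^*$ of any inner dimension, where $u_i$ and $v_j$ are the rows of $U$ and $V$. Let $K_G$ be the real Grothendieck constant, i.e. the least $K$ such that for all real matrices $(a_{ij})$ and all unit vectors $x_i,y_j$ of a Euclidean space one has $\left|\sum_{i,j}a_{ij}\langle x_i,y_j\rangle\right|\le K\max_{s_i,t_j\in\{-1,1\}}\left|\sum_{i,j}a_{ij}s_it_j\right|$. **Theorem.** Let $Y\in\mathbb{R}^{n\times m}$ and $\delta\in\mathbb{R}$. Suppose we observe $Z_{ij}=Y_{ij}+\epsilon_{ij}$ for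 $(i,j)\in E$, with bounded error $$\frac1{|E|}\sum_{(i,j)\in E}\epsilon_{ij}^2\le\delta^2 .$$ Then every solution $\hat Y$ of the optimization problem $$\text{minimize }\gamma_2(X)\text{ over }X\in\mathbb{R}^{n\times m}\quad\text{subject to}\quad \frac1{|E|}\sum_{(i,j)\in E}(X_{ij}-Z_{ij})^2\le\delta^2$$ satisfies $$\frac1{nm}\|\hat Y-Y\|_F^2\le c\,\gamma_2(Y)^2\,\frac{\eta}{\sqrt{d_1d_2}}+4\delta^2,\qquad c=4K_G\le 7.13 ,$$ where $\|\cdot\|_F$ is the Frobenius norm. -/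

import Mathlib

attribute [local instance] Matrix.frobeniusNormedAddCommGroup

noncomputable section

/-- `G` is a bipartite graph with parts `[n]` and `[m]`, every vertex of the first part having
degree `d₁` and every vertex of the second part having degree `d₂`. -/
def IsBiregularBipartite {n m : ℕ} (G : SimpleGraph (Fin n ⊕ Fin m)) [DecidableRel G.Adj]
    (d₁ d₂ : ℕ) : Prop :=
  G.IsBipartiteWith (Set.range Sum.inl) (Set.range Sum.inr) ∧
    (∀ i : Fin n, G.degree (Sum.inl i) = d₁) ∧ (∀ j : Fin m, G.degree (Sum.inr j) = d₂)

/-- The edges of a bipartite graph, viewed as a set `E ⊆ [n] × [m]` of matrix positions. -/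
def edgePositions {n m : ℕ} (G : SimpleGraph (Fin n ⊕ Fin m)) [DecidableRel G.Adj] :
    Finset (Fin n × Fin m) :=
  Finset.univ.filter fun p => G.Adj (Sum.inl p.1) (Sum.inr p.2)

theorem adjMatrix_isHermitian_real {V : Type*} [Fintype V] [DecidableEq V] (G : SimpleGraph V)
    [DecidableRel G.Adj] : (G.adjMatrix ℝ).IsHermitian := by
  rw [Matrix.IsHermitian, Matrix.conjTranspose_eq_transpose_of_trivial]
  exact G.isSymm_adjMatrix

/-- The second largest eigenvalue `λ₂` (eigenvalues `λ₁ ≥ λ₂ ≥ ⋯` counted with multiplicity) of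
the adjacency matrix. `Matrix.IsHermitian.eigenvalues₀` lists them in decreasing order, starting
from index `0`. The value is `0` by convention if there are fewer than two vertices. -/
def secondEigenvalue {V : Type*} [Fintype V] [DecidableEq V] (G : SimpleGraph V)
    [DecidableRel G.Adj] : ℝ :=
  if h : 1 < Fintype.card V then (adjMatrix_isHermitian_real G).eigenvalues₀ ⟨1, h⟩ else 0

/-- The norm `‖U‖_{ℓ₂ → ℓ_∞}`: the largest Euclidean norm of a row of `U`. -/
def maxRowNorm {n k : ℕ} (U : Matrix (Fin n) (Fin k) ℝ) : ℝ :=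
  ⨆ i, Real.sqrt (∑ j, U i j ^ 2)

/-- The factorization norm `γ₂(Y)`: the infimum (which is attained) of
`‖U‖_{ℓ₂ → ℓ_∞} ‖V‖_{ℓ₂ → ℓ_∞}` over all factorizations `Y = U V*`, of any inner dimension. -/
def gammaTwo {n m : ℕ} (Y : Matrix (Fin n) (Fin m) ℝ) : ℝ :=
  sInf {r : ℝ | ∃ (k : ℕ) (U : Matrix (Fin n) (Fin k) ℝ) (V : Matrix (Fin m) (Fin k) ℝ),
    U * V.transpose = Y ∧ r = maxRowNorm U * maxRowNorm V}

/-- Grothendieck's inequality with constant `K`: for every real matrix `A`, if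
`|∑ A_{ij} s_i t_j| ≤ C` for all signs `s_i, t_j`, then `|∑ A_{ij} ⟨x_i, y_j⟩| ≤ K C` for all unit
vectors `x_i, y_j` of a real Euclidean space of any dimension. -/
def GrothendieckInequality (K : ℝ) : Prop :=
  ∀ (k l : ℕ) (A : Matrix (Fin k) (Fin l) ℝ) (C : ℝ),
    (∀ (s : Fin k → ℝ) (t : Fin l → ℝ), (∀ i, s i = 1 ∨ s i = -1) → (∀ j, t j = 1 ∨ t j = -1) →
      |∑ i, ∑ j, A i j * (s i * t j)| ≤ C) →
    ∀ (N : ℕ) (x : Fin k → EuclideanSpace ℝ (Fin N)) (y : Fin l → EuclideanSpace ℝ (Fin N)),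
      (∀ i, ‖x i‖ = 1) → (∀ j, ‖y j‖ = 1) →
        |∑ i, ∑ j, A i j * inner ℝ (x i) (y j)| ≤ K * C

/-- The real Grothendieck constant `K_G`: the best constant in Grothendieck's inequality. -/
def grothendieckConstant : ℝ := sInf {K : ℝ | GrothendieckInequality K}

/-- The mean of the squares of the entries of `X` over the positions in `E`. -/
def meanSquareOn {n m : ℕ} (E : Finset (Fin n × Fin m)) (X : Matrix (Fin n) (Fin m) ℝ) : ℝ :=
  (1 / (E.card : ℝ)) * ∑ p ∈ E, X p.1 p.2 ^ 2

/-- `W` solves the problem: minimize `γ₂(X)` subject to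
`(1/|E|) ∑_{(i,j) ∈ E} (X_{ij} - Z_{ij})² ≤ δ²`. -/
def IsNoisyCompletion {n m : ℕ} (E : Finset (Fin n × Fin m)) (Z : Matrix (Fin n) (Fin m) ℝ)
    (δ : ℝ) (W : Matrix (Fin n) (Fin m) ℝ) : Prop :=
  meanSquareOn E (W - Z) ≤ δ ^ 2 ∧
    ∀ X : Matrix (Fin n) (Fin m) ℝ, meanSquareOn E (X - Z) ≤ δ ^ 2 → gammaTwo W ≤ gammaTwo X

end

/-!
A matrix `X` with `γ₂(X) < R` has entries `⟪u i, v j⟫` with `‖u i‖², ‖v j‖² ≤ R`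
(`exists_inner_of_gammaTwo_lt`). The matrix `Y` satisfies the constraint, so `γ₂(Ŷ) ≤ γ₂(Y)`, and
concatenation of vectors writes `X = Ŷ - Y` with vectors of squared norm at most `2 * R`, for every
`R > γ₂(Y)`. The squares `X i j ^ 2` are then scalar products of the tensor squares of these
vectors, of norm at most `2 * R` again.

The matrix `A = 1_E / |E| - 1 / (n m)` satisfies `|∑ A i j * s i * t j| ≤ η / √(d₁ d₂)` for all signs
(`IsBiregularBipartite.discrepancy_le`), because the quadratic form of the adjacency matrix is at
most `η` on the complement of its top eigenvector. Grothendieck's inequality, applied to `A` and the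
tensor squares, compares the mean of `X i j ^ 2` over all positions with the mean over `E`, up to
`K_G * (2 * R) ^ 2 * η / √(d₁ d₂)`. The mean over `E` is at most `4 * δ ^ 2`, since both `Ŷ` and `Y`
are within `δ` of `Z` there.

The numerical bound on `K_G`, which also shows that some constant is admissible in Grothendieck's
inequality at all, is Krivine's `K_G ≤ π / (2 * arsinh 1)` (`grothendieckInequality_krivine`). Two
standard Gaussian variables of covariance `ρ` have signs whose product has mean
`(2 / π) * arcsin ρ`. This mean is linear in `⟪x i, y j⟫` if `ρ = sin (c * ⟪x i, y j⟫)`; for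
`c = arsinh 1` there are Gaussian variables with these covariances, since the matrix with blocks
`sinh (c * ⟪x i, x i'⟫)`, `sin (c * ⟪x i, y j⟫)`, `sinh (c * ⟪y j, y j'⟫)` is positive semidefinite by
the Schur product theorem and has diagonal entries `sinh c = 1`.
-/

open Real MeasureTheory ProbabilityTheory Set
open scoped Nat Matrix

/-! ### Signs of Gaussian variables in the plane -/

/-- The sign of a real number, with the convention that `0` has sign `1`, so that the values are
always `1` or `-1`. -/
noncomputable def pmSign (t : ℝ) : ℝ := if 0 ≤ t then 1 else -1

lemma pmSign_eq_one_or (t : ℝ) : pmSign t = 1 ∨ pmSign t = -1 := by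
  unfold pmSign; split_ifs <;> simp

lemma pmSign_of_nonneg {t : ℝ} (h : 0 ≤ t) : pmSign t = 1 := if_pos h

lemma pmSign_of_neg {t : ℝ} (h : t < 0) : pmSign t = -1 := if_neg h.not_ge

lemma pmSign_mul_of_pos {r : ℝ} (hr : 0 < r) (t : ℝ) : pmSign (r * t) = pmSign t := by
  simp [pmSign, mul_nonneg_iff_of_pos_left hr]

lemma measurable_pmSign : Measurable pmSign :=
  Measurable.ite measurableSet_Ici measurable_const measurable_const

lemma abs_pmSign (t : ℝ) : |pmSign t| = 1 := by
  rcases pmSign_eq_one_or t with h | h <;> simp [h]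

lemma intervalIntegrable_and_integral_of_eqOn_Ioo {f : ℝ → ℝ} {a b c : ℝ} (hab : a ≤ b)
    (h : ∀ x ∈ Ioo a b, f x = c) :
    IntervalIntegrable f volume a b ∧ ∫ x in a..b, f x = (b - a) * c := by
  have hae : (fun _ => c) =ᵐ[volume.restrict (uIoc a b)] f := by
    rw [uIoc_of_le hab, ← Measure.restrict_congr_set Ioo_ae_eq_Ioc]
    filter_upwards [ae_restrict_mem measurableSet_Ioo] with x hx using (h x hx).symm
  refine ⟨(intervalIntegrable_const (c := c)).congr_ae hae, ?_⟩
  rw [← intervalIntegral.integral_congr_ae_restrict hae]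
  simp

/-- Among the directions of the plane, the product of the signs of the scalar products with two
unit vectors at angle `θ` is `-1` on a set of angular measure `2 * θ`. -/
lemma integral_pmSign_cos_mul_pmSign_cos_sub {θ : ℝ} (h0 : 0 ≤ θ) (hπ : θ ≤ π) :
    ∫ α in (-π)..π, pmSign (cos α) * pmSign (cos (α - θ)) = 2 * π - 4 * θ := by
  set f : ℝ → ℝ := fun α => pmSign (cos α) * pmSign (cos (α - θ)) with hf
  have hper : Function.Periodic f (2 * π) := by
    intro α
    have : α + 2 * π - θ = (α - θ) + 2 * π := by ring
    simp only [hf, this, cos_add_two_pi]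
  have hshift : ∫ α in (-π)..π, f α = ∫ α in (-(π / 2))..(-(π / 2) + 2 * π), f α := by
    rw [← hper.intervalIntegral_add_eq (-π)]
    congr 1; ring
  rw [hshift]
  have cneg : ∀ x, π / 2 < x → x < 3 * π / 2 → cos x < 0 := fun x h1 h2 =>
    cos_neg_of_pi_div_two_lt_of_lt h1 (by linarith)
  have cneg' : ∀ x, -(3 * π / 2) < x → x < -(π / 2) → cos x < 0 := fun x h1 h2 => by
    rw [← cos_neg]; exact cneg _ (by linarith) (by linarith)
  have cpos : ∀ x, -(π / 2) < x → x < π / 2 → 0 ≤ cos x := fun x h1 h2 =>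
    (cos_pos_of_mem_Ioo ⟨h1, h2⟩).le
  have cpos' : ∀ x, 3 * π / 2 < x → x < 2 * π → 0 ≤ cos x := fun x h1 h2 => by
    rw [← cos_sub_two_pi]; exact cpos _ (by linarith) (by linarith)
  have I1 := intervalIntegrable_and_integral_of_eqOn_Ioo (f := f) (a := -(π / 2))
    (b := θ - π / 2) (c := -1) (by linarith) fun x hx => by
      simp only [hf]
      rw [pmSign_of_nonneg (cpos x hx.1 (by linarith [hx.2])),
        pmSign_of_neg (cneg' (x - θ) (by linarith [hx.1]) (by linarith [hx.2]))]
      norm_num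
  have I2 := intervalIntegrable_and_integral_of_eqOn_Ioo (f := f) (a := θ - π / 2)
    (b := π / 2) (c := 1) (by linarith) fun x hx => by
      simp only [hf]
      rw [pmSign_of_nonneg (cpos x (by linarith [hx.1]) hx.2),
        pmSign_of_nonneg (cpos (x - θ) (by linarith [hx.1]) (by linarith [hx.2]))]
      norm_num
  have I3 := intervalIntegrable_and_integral_of_eqOn_Ioo (f := f) (a := π / 2)
    (b := θ + π / 2) (c := -1) (by linarith) fun x hx => by
      simp only [hf]
      rw [pmSign_of_neg (cneg x hx.1 (by linarith [hx.2])),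
        pmSign_of_nonneg (cpos (x - θ) (by linarith [hx.1]) (by linarith [hx.2]))]
      norm_num
  have I4 := intervalIntegrable_and_integral_of_eqOn_Ioo (f := f) (a := θ + π / 2)
    (b := -(π / 2) + 2 * π) (c := 1) (by linarith) fun x hx => by
      simp only [hf]
      rw [pmSign_of_neg (cneg x (by linarith [hx.1]) (by linarith [hx.2])),
        pmSign_of_neg (cneg (x - θ) (by linarith [hx.1]) (by linarith [hx.2]))]
      norm_num
  rw [← intervalIntegral.integral_add_adjacent_intervals
      ((I1.1.trans I2.1).trans I3.1) I4.1,
    ← intervalIntegral.integral_add_adjacent_intervals (I1.1.trans I2.1) I3.1,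
    ← intervalIntegral.integral_add_adjacent_intervals I1.1 I2.1, I1.2, I2.2, I3.2, I4.2]
  ring

lemma integral_prod_gaussianReal_eq_polar (F : ℝ × ℝ → ℝ) (H : ℝ → ℝ)
    (hF : ∀ r α, 0 < r → F (r * cos α, r * sin α) = H α) :
    ∫ p, F p ∂((gaussianReal 0 1).prod (gaussianReal 0 1)) =
      (∫ r in Ioi (0 : ℝ), r * ((2 * π)⁻¹ * exp (-(r ^ 2 / 2)))) * ∫ α in Ioo (-π) π, H α := by
  rw [gaussianReal_of_var_ne_zero 0 one_ne_zero,
    prod_withDensity (measurable_gaussianPDF _ _) (measurable_gaussianPDF _ _),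
    integral_withDensity_eq_integral_toReal_smul (by fun_prop)
      (Filter.Eventually.of_forall fun p => by
        exact ENNReal.mul_lt_top gaussianPDF_lt_top gaussianPDF_lt_top),
    ← Measure.volume_eq_prod, ← integral_comp_polarCoord_symm, polarCoord_target,
    Measure.volume_eq_prod, ← setIntegral_prod_mul]
  refine setIntegral_congr_fun (measurableSet_Ioi.prod measurableSet_Ioo) fun p hp => ?_
  have hp1 : 0 < p.1 := hp.1
  simp only [polarCoord_symm_apply, ENNReal.toReal_mul, toReal_gaussianPDF, smul_eq_mul,
    hF _ _ hp1, gaussianPDFReal]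
  have hexp : exp (-(p.1 ^ 2 / 2)) =
      exp (-(p.1 * cos p.2) ^ 2 / 2) * exp (-(p.1 * sin p.2) ^ 2 / 2) := by
    rw [← exp_add]
    congr 1
    linear_combination (p.1 ^ 2 / 2) * (sin_sq_add_cos_sq p.2)
  have hs : (2 * π)⁻¹ = (√(2 * π))⁻¹ * (√(2 * π))⁻¹ := by
    rw [← mul_inv, mul_self_sqrt (by positivity)]
  simp only [sub_zero, NNReal.coe_one, mul_one]
  rw [hexp, hs]
  ring

/-- The law of the angle of a standard Gaussian vector in the plane is uniform: the integral of a
function that is constant on rays is its average over the angles. -/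
lemma integral_prod_gaussianReal_of_const_on_rays (F : ℝ × ℝ → ℝ) (H : ℝ → ℝ)
    (hF : ∀ r α, 0 < r → F (r * cos α, r * sin α) = H α) :
    ∫ p, F p ∂((gaussianReal 0 1).prod (gaussianReal 0 1)) =
      (2 * π)⁻¹ * ∫ α in (-π)..π, H α := by
  have hone := integral_prod_gaussianReal_eq_polar (fun _ => 1) (fun _ => 1) fun _ _ _ => rfl
  -- The radial integral is found by taking the function `1`, whose integral is `1`.
  have hrad : (∫ r in Ioi (0 : ℝ), r * ((2 * π)⁻¹ * exp (-(r ^ 2 / 2)))) = (2 * π)⁻¹ := by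
    have h2 : ∫ _ in Ioo (-π) π, (1 : ℝ) = 2 * π := by
      simp [pi_pos.le]; ring
    rw [h2] at hone
    simp only [integral_const, probReal_univ, smul_eq_mul, mul_one] at hone
    exact eq_inv_of_mul_eq_one_left hone.symm
  rw [integral_prod_gaussianReal_eq_polar F H hF, hrad,
    intervalIntegral.integral_of_le (by linarith [pi_pos]), integral_Ioc_eq_integral_Ioo]

/-- **Grothendieck's identity** for a pair of standard Gaussian variables with covariance
`cos θ`. -/
lemma integral_pmSign_mul_pmSign_prod_gaussianReal {θ : ℝ} (h0 : 0 ≤ θ) (hπ : θ ≤ π) :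
    ∫ p, pmSign p.1 * pmSign (cos θ * p.1 + sin θ * p.2)
      ∂((gaussianReal 0 1).prod (gaussianReal 0 1)) = 1 - 2 * θ / π := by
  rw [integral_prod_gaussianReal_of_const_on_rays _
    (fun α => pmSign (cos α) * pmSign (cos (α - θ))), integral_pmSign_cos_mul_pmSign_cos_sub h0 hπ]
  · field_simp
    ring
  · intro r α hr
    have : cos θ * (r * cos α) + sin θ * (r * sin α) = r * cos (α - θ) := by
      rw [cos_sub]; ring
    simp only [this, pmSign_mul_of_pos hr]

/-! ### Grothendieck's identity -/

/-- **Grothendieck's identity**: if two standard Gaussian variables have covariance `ρ` then the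
product of their signs has expectation `(2 / π) * arcsin ρ`. -/
lemma integral_pmSign_mul_pmSign_multivariateGaussian {ι : Type*} [Fintype ι] [DecidableEq ι]
    {S : Matrix ι ι ℝ} (hS : S.PosSemidef) (hdiag : ∀ i, S i i = 1) (i j : ι)
    (hρ : |S i j| ≤ 1) :
    ∫ g, pmSign (g i) * pmSign (g j) ∂(multivariateGaussian 0 S) =
      2 / π * arcsin (S i j) := by
  set μ := multivariateGaussian (0 : EuclideanSpace ℝ ι) S with hμ
  set ρ := S i j with hρdef
  set θ := arccos ρ with hθ
  have hcos : cos θ = ρ := cos_arccos (abs_le.1 hρ).1 (abs_le.1 hρ).2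
  -- The part of the second variable that is uncorrelated with the first.
  let X : EuclideanSpace ℝ ι → ℝ := fun g => g i
  let W : EuclideanSpace ℝ ι → ℝ := fun g => g j - ρ * g i
  let LX : EuclideanSpace ℝ ι →L[ℝ] ℝ := EuclideanSpace.proj i
  let LW : EuclideanSpace ℝ ι →L[ℝ] ℝ := EuclideanSpace.proj j - ρ • EuclideanSpace.proj i
  have hXW : HasGaussianLaw (fun g => (X g, W g)) μ :=
    (IsGaussian.hasGaussianLaw_id (μ := μ)).map_fun (LX.prod LW)
  have hi : HasGaussianLaw (fun g : EuclideanSpace ℝ ι => g i) μ :=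
    (IsGaussian.hasGaussianLaw_id (μ := μ)).map_fun (EuclideanSpace.proj (𝕜 := ℝ) i)
  have hj : HasGaussianLaw (fun g : EuclideanSpace ℝ ι => g j) μ :=
    (IsGaussian.hasGaussianLaw_id (μ := μ)).map_fun (EuclideanSpace.proj (𝕜 := ℝ) j)
  have hi2 := hi.memLp_two
  have hj2 := hj.memLp_two
  have hcov : ∀ a b : ι, cov[fun g => g a, fun g => g b; μ] = S a b :=
    fun a b => covariance_eval_multivariateGaussian hS a b
  have hXWcov : cov[X, W; μ] = 0 := by
    change cov[fun g : EuclideanSpace ℝ ι => g i, fun g => g j - ρ * g i; μ] = 0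
    rw [covariance_fun_sub_right hi2 hj2 (hi2.const_mul ρ), covariance_const_mul_right,
      hcov, hcov, hdiag]
    simp [hρdef]
  have hWvar : Var[W; μ] = sin θ ^ 2 := by
    change Var[fun g : EuclideanSpace ℝ ι => g j - ρ * g i; μ] = _
    rw [variance_fun_sub hj2 (hi2.const_mul ρ), variance_const_mul, covariance_const_mul_right,
      ← covariance_self hi.aemeasurable, ← covariance_self hj.aemeasurable, hcov, hcov, hcov,
      hdiag, hdiag, sin_sq, hcos]
    have hsymm : S j i = S i j := by simpa using hS.isHermitian.apply i j
    rw [hsymm, ← hρdef]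
    ring
  have hmean : ∀ a : ι, ∫ g, g a ∂μ = 0 := by
    intro a
    have := ((EuclideanSpace.proj (𝕜 := ℝ) a : EuclideanSpace ℝ ι →L[ℝ] ℝ)).integral_comp_id_comm
      (μ := μ) IsGaussian.integrable_id
    rw [hμ, integral_id_multivariateGaussian] at this
    simpa using this
  have hWmean : ∫ g, W g ∂μ = 0 := by
    change ∫ g, (g j - ρ * g i) ∂μ = 0
    rw [integral_sub hj.integrable (hi.integrable.const_mul ρ), integral_const_mul, hmean, hmean]
    simp
  have hind : IndepFun X W μ := hXW.indepFun_of_covariance_eq_zero hXWcov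
  have hXlaw : μ.map X = gaussianReal 0 1 := by
    rw [hXW.fst.map_eq_gaussianReal]
    change gaussianReal (∫ g, g i ∂μ) (Var[fun g => g i; μ]).toNNReal = _
    rw [hmean, ← covariance_self hi.aemeasurable, hcov, hdiag]
    simp
  have hWlaw : μ.map W = (gaussianReal 0 1).map (fun x => sin θ * x) := by
    rw [hXW.snd.map_eq_gaussianReal, hWmean, hWvar, gaussianReal_map_const_mul]
    congr 1
    · simp
    · ext; simp [sq_nonneg]
  have hlaw : μ.map (fun g => (X g, W g)) =
      ((gaussianReal 0 1).prod (gaussianReal 0 1)).map (Prod.map id fun x => sin θ * x) := by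
    rw [(indepFun_iff_map_prod_eq_prod_map_map hXW.fst.aemeasurable hXW.snd.aemeasurable).1 hind,
      hXlaw, hWlaw, ← Measure.map_prod_map _ _ measurable_id (by fun_prop), Measure.map_id]
  have hmeas : Measurable fun p : ℝ × ℝ => pmSign p.1 * pmSign (cos θ * p.1 + p.2) :=
    (measurable_pmSign.comp measurable_fst).mul (measurable_pmSign.comp (by fun_prop))
  have hfun : (fun g : EuclideanSpace ℝ ι => pmSign (g i) * pmSign (g j)) =
      fun g => (fun p : ℝ × ℝ => pmSign p.1 * pmSign (cos θ * p.1 + p.2)) (X g, W g) := by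
    ext g
    simp only [X, W, hcos]
    congr 2
    ring
  rw [hfun, ← integral_map (f := fun p : ℝ × ℝ => pmSign p.1 * pmSign (cos θ * p.1 + p.2))
      hXW.aemeasurable hmeas.aestronglyMeasurable, hlaw,
    integral_map (by fun_prop) hmeas.aestronglyMeasurable]
  simp only [Prod.map_fst, Prod.map_snd, id]
  rw [integral_pmSign_mul_pmSign_prod_gaussianReal (arccos_nonneg _) (arccos_le_pi _), arccos]
  field_simp
  ring

/-! ### Krivine's bound for the Grothendieck constant -/

namespace Matrix

/-- The Hadamard powers of a positive semidefinite matrix, with rows and columns multiplied by the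
`k`-th power of a vector, are positive semidefinite. -/
lemma PosSemidef.of_pow_mul_pow {ι : Type*} [Fintype ι] {A : Matrix ι ι ℝ} (hA : A.PosSemidef)
    (σ : ι → ℝ) (k p : ℕ) :
    (of fun a b => (σ a * σ b) ^ k * A a b ^ p).PosSemidef := by
  induction p with
  | zero =>
    have := posSemidef_vecMulVec_self_star (fun a => σ a ^ k)
    convert this using 1
    ext a b
    simp [vecMulVec_apply, mul_pow]
  | succ p ih =>
    have h : (of fun a b => (σ a * σ b) ^ k * A a b ^ (p + 1)) =
        (of fun a b => (σ a * σ b) ^ k * A a b ^ p) ⊙ A := by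
      ext a b
      simp [hadamard_apply, pow_succ, mul_assoc]
    rw [h]
    exact ih.hadamard hA

/-- Krivine's kernel: take `sinh` entrywise within the two blocks of a positive semidefinite matrix
and `sin` entrywise between them. The power series of the two functions differ only by the signs
`(-1) ^ k`, which between the blocks come from a sign change of the rows and columns of the second
block. -/
lemma PosSemidef.sinh_sin_blocks {ι : Type*} [Fintype ι] {A : Matrix ι ι ℝ} (hA : A.PosSemidef)
    (side : ι → Bool) :
    (of fun a b => if side a = side b then sinh (A a b) else sin (A a b)).PosSemidef := by
  have hsymm : ∀ a b, A b a = A a b := fun a b => by simpa using hA.isHermitian.apply a b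
  rw [posSemidef_iff_dotProduct_mulVec]
  refine ⟨?_, fun v => ?_⟩
  · ext a b
    simp only [conjTranspose_apply, of_apply, star_trivial, hsymm a b, eq_comm (a := side b)]
  let σ : ι → ℝ := fun a => if side a then 1 else -1
  let T : ℕ → Matrix ι ι ℝ := fun k => of fun a b => (σ a * σ b) ^ k * A a b ^ (2 * k + 1)
  have hT : ∀ k, (T k).PosSemidef := fun k => hA.of_pow_mul_pow σ k _
  have hentry : ∀ a b, HasSum (fun k => T k a b / (2 * k + 1)!)
      (if side a = side b then sinh (A a b) else sin (A a b)) := by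
    intro a b
    split_ifs with h
    · have hσ : σ a * σ b = 1 := by
        simp only [σ, h]; split_ifs <;> norm_num
      simpa [T, hσ] using Real.hasSum_sinh (A a b)
    · have hσ : σ a * σ b = -1 := by
        simp only [σ]
        cases ha : side a <;> cases hb : side b <;> simp_all
      simpa [T, hσ] using Real.hasSum_sin (A a b)
  have hform : HasSum (fun k => (star v ⬝ᵥ (T k *ᵥ v)) / (2 * k + 1)!)
      (star v ⬝ᵥ ((of fun a b => if side a = side b then sinh (A a b) else sin (A a b)) *ᵥ v)) := by
    simp only [dotProduct, mulVec, star_trivial, of_apply, Finset.mul_sum, Finset.sum_div]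
    refine hasSum_sum fun a _ => hasSum_sum fun b _ => ?_
    have hterm : (fun k => v a * (T k a b * v b) / (2 * k + 1)!) =
        fun k => v a * (T k a b / (2 * k + 1)! * v b) := by
      ext k
      ring
    have hab := ((hentry a b).mul_right (v b)).mul_left (v a)
    rw [← hterm] at hab
    exact hab
  exact hform.nonneg fun k => div_nonneg ((hT k).dotProduct_mulVec_nonneg v) (by positivity)

end Matrix

lemma arsinh_one_le_one : arsinh 1 ≤ 1 := by
  rw [← sinh_le_sinh, sinh_arsinh]
  exact self_le_sinh_iff.2 zero_le_one

/-- **Krivine's bound** for Grothendieck's inequality. Gaussian variables `S i`, `T j` of variance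
`1` with covariances `sin (c * ⟪x i, y j⟫)`, `c = arsinh 1`, exist by the positivity of Krivine's
kernel; by Grothendieck's identity the expected products of their signs are
`(2 / π) * c * ⟪x i, y j⟫`. -/
theorem grothendieckInequality_krivine : GrothendieckInequality (π / (2 * arsinh 1)) := by
  intro k l A C hC N x y hx hy
  set c := arsinh 1 with hc
  have hc0 : 0 < c := arsinh_pos_iff.2 one_pos
  have hc1 : c ≤ 1 := arsinh_one_le_one
  let z : Fin k ⊕ Fin l → EuclideanSpace ℝ (Fin N) := Sum.elim x y
  have hz : ∀ a, ‖z a‖ = 1 := by rintro (i | j) <;> simp [z, hx, hy]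
  have hgram : (c • Matrix.gram ℝ z).PosSemidef := (Matrix.posSemidef_gram ℝ z).smul hc0.le
  let S := Matrix.of fun a b => if Sum.isLeft a = Sum.isLeft b then
    sinh ((c • Matrix.gram ℝ z) a b) else sin ((c • Matrix.gram ℝ z) a b)
  have hS : S.PosSemidef := hgram.sinh_sin_blocks Sum.isLeft
  have hdiag : ∀ a, S a a = 1 := by
    intro a
    simp [S, Matrix.gram_apply, hz, hc, sinh_arsinh]
  have hoff : ∀ i j, S (Sum.inl i) (Sum.inr j) = sin (c * inner ℝ (x i) (y j)) := by
    intro i j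
    simp [S, Matrix.gram_apply, z]
  have hint : ∀ i j, ∫ g, pmSign (g (Sum.inl i)) * pmSign (g (Sum.inr j))
      ∂(multivariateGaussian 0 S) = 2 / π * (c * inner ℝ (x i) (y j)) := by
    intro i j
    have hxy : |c * inner ℝ (x i) (y j)| ≤ 1 := by
      rw [abs_mul, abs_of_pos hc0]
      have := abs_real_inner_le_norm (x i) (y j)
      rw [hx, hy, mul_one] at this
      nlinarith [abs_nonneg (inner ℝ (x i) (y j))]
    rw [integral_pmSign_mul_pmSign_multivariateGaussian hS hdiag _ _
      (by rw [hoff]; exact abs_sin_le_one _), hoff, arcsin_sin]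
    · linarith [(abs_le.1 hxy).1, pi_gt_three]
    · linarith [(abs_le.1 hxy).2, pi_gt_three]
  set μ := multivariateGaussian (0 : EuclideanSpace ℝ (Fin k ⊕ Fin l)) S
  have hmeas : ∀ a, Measurable fun g : EuclideanSpace ℝ (Fin k ⊕ Fin l) => pmSign (g a) :=
    fun a => measurable_pmSign.comp (by fun_prop)
  have hintegrable : ∀ i j, Integrable (fun g : EuclideanSpace ℝ (Fin k ⊕ Fin l) =>
      A i j * (pmSign (g (Sum.inl i)) * pmSign (g (Sum.inr j)))) μ := by
    intro i j
    refine Integrable.const_mul ?_ _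
    refine Integrable.of_bound ((hmeas _).mul (hmeas _)).aestronglyMeasurable 1 ?_
    exact Filter.Eventually.of_forall fun g => by simp [abs_pmSign]
  have hsum : ∫ g, (∑ i, ∑ j, A i j * (pmSign (g (Sum.inl i)) * pmSign (g (Sum.inr j)))) ∂μ =
      2 * c / π * ∑ i, ∑ j, A i j * inner ℝ (x i) (y j) := by
    rw [integral_finsetSum _ fun i _ => integrable_finsetSum _ fun j _ => hintegrable i j,
      Finset.mul_sum]
    refine Finset.sum_congr rfl fun i _ => ?_
    rw [integral_finsetSum _ fun j _ => hintegrable i j, Finset.mul_sum]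
    refine Finset.sum_congr rfl fun j _ => ?_
    rw [integral_const_mul, hint]
    ring
  have hbound : ‖∫ g, (∑ i, ∑ j, A i j * (pmSign (g (Sum.inl i)) * pmSign (g (Sum.inr j)))) ∂μ‖ ≤
      C * μ.real univ :=
    norm_integral_le_of_norm_le_const <| Filter.Eventually.of_forall fun g =>
      hC _ _ (fun i => pmSign_eq_one_or _) fun j => pmSign_eq_one_or _
  rw [hsum, probReal_univ, mul_one, norm_eq_abs, abs_mul, abs_of_pos (by positivity)] at hbound
  calc |∑ i, ∑ j, A i j * inner ℝ (x i) (y j)|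
      = π / (2 * c) * (2 * c / π * |∑ i, ∑ j, A i j * inner ℝ (x i) (y j)|) := by
        field_simp
    _ ≤ π / (2 * c) * C := by gcongr

lemma lt_arsinh_one : 0.8813 < arsinh 1 := by
  rw [← sinh_lt_sinh, sinh_arsinh, sinh_eq, exp_neg]
  have h : exp (0.8813 : ℝ) ≤ 2.4141 := by
    refine (exp_bound' (by norm_num) (by norm_num) (n := 10) (by norm_num)).trans ?_
    norm_num [Finset.sum_range_succ, Nat.factorial]
  have h' : (2.4141 : ℝ)⁻¹ ≤ (exp (0.8813 : ℝ))⁻¹ := inv_anti₀ (exp_pos _) h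
  norm_num at h h' ⊢
  linarith

lemma one_le_of_grothendieckInequality {K : ℝ} (hK : GrothendieckInequality K) : 1 ≤ K := by
  have h := hK 1 1 1 1 (fun s t hs ht => by
      rcases hs 0 with h | h <;> rcases ht 0 with h' | h' <;> simp [h, h'])
    1 (fun _ => EuclideanSpace.single 0 1) (fun _ => EuclideanSpace.single 0 1)
    (by simp) (by simp)
  simpa using h

lemma bddBelow_grothendieckInequality : BddBelow {K : ℝ | GrothendieckInequality K} :=
  ⟨1, fun _ hK => one_le_of_grothendieckInequality hK⟩

lemma four_mul_grothendieckConstant_le : 4 * grothendieckConstant ≤ 7.13 := by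
  have h : grothendieckConstant ≤ π / (2 * arsinh 1) :=
    csInf_le bddBelow_grothendieckInequality grothendieckInequality_krivine
  have h2 : π / (2 * arsinh 1) ≤ 7.13 / 4 := by
    have := lt_arsinh_one
    rw [div_le_iff₀ (by linarith)]
    have := pi_lt_d6
    norm_num at *
    linarith
  linarith

/-- The infimum in the definition of the Grothendieck constant is attained. -/
lemma grothendieckInequality_grothendieckConstant :
    GrothendieckInequality grothendieckConstant := by
  intro k l A C hC N x y hx hy
  have hC0 : 0 ≤ C := (abs_nonneg _).trans
    (hC (fun _ => 1) (fun _ => 1) (fun _ => Or.inl rfl) fun _ => Or.inl rfl)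
  rcases hC0.eq_or_lt with rfl | hC0
  · simpa using grothendieckInequality_krivine k l A 0 hC N x y hx hy
  rw [← div_le_iff₀ hC0]
  exact le_csInf ⟨_, grothendieckInequality_krivine⟩ fun K hK =>
    (div_le_iff₀ hC0).2 (hK k l A C hC N x y hx hy)

/-! ### Quadratic forms and the second eigenvalue -/

namespace Matrix.IsHermitian

variable {V : Type*} [Fintype V] {A : Matrix V V ℝ}

lemma dotProduct_mulVec_comm (hA : A.IsHermitian) (x y : V → ℝ) :
    x ⬝ᵥ (A *ᵥ y) = y ⬝ᵥ (A *ᵥ x) := by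
  have hT : Aᵀ = A := by rw [← conjTranspose_eq_transpose_of_trivial]; exact hA
  rw [dotProduct_mulVec, ← mulVec_transpose, hT, dotProduct_comm]

variable [DecidableEq V]

lemma sum_dotProduct_eigenvectorBasis (hA : A.IsHermitian) (x y : V → ℝ) :
    ∑ i, (hA.eigenvectorBasis i ⬝ᵥ x) * (hA.eigenvectorBasis i ⬝ᵥ y) = x ⬝ᵥ y := by
  have h := hA.eigenvectorBasis.sum_inner_mul_inner (WithLp.toLp 2 x) (WithLp.toLp 2 y)
  simp only [EuclideanSpace.inner_eq_star_dotProduct, star_trivial] at h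
  rw [dotProduct_comm x y, ← h]
  refine Finset.sum_congr rfl fun i _ => ?_
  rw [dotProduct_comm _ y]

/-- The second largest eigenvalue bounds the quadratic form on the orthogonal complement of a
single vector, namely the first vector of an eigenbasis. -/
lemma exists_forall_dotProduct_mulVec_le_eigenvalues₀_one (hA : A.IsHermitian)
    (h : 1 < Fintype.card V) :
    ∃ b : V → ℝ, ∀ y, b ⬝ᵥ y = 0 → y ⬝ᵥ (A *ᵥ y) ≤ hA.eigenvalues₀ ⟨1, h⟩ * (y ⬝ᵥ y) := by
  set e : Fin (Fintype.card V) ≃ V := Fintype.equivOfCardEq (Fintype.card_fin _) with he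
  refine ⟨hA.eigenvectorBasis (e ⟨0, by omega⟩), fun y hy => ?_⟩
  rw [← hA.sum_dotProduct_eigenvectorBasis y (A *ᵥ y), ← hA.sum_dotProduct_eigenvectorBasis y y,
    Finset.mul_sum]
  refine Finset.sum_le_sum fun i _ => ?_
  rw [hA.dotProduct_mulVec_comm, mulVec_eigenvectorBasis, dotProduct_smul, smul_eq_mul,
    dotProduct_comm y]
  by_cases hi : i = e ⟨0, by omega⟩
  · rw [hi, hy]; simp
  have hle : hA.eigenvalues i ≤ hA.eigenvalues₀ ⟨1, h⟩ := by
    refine hA.eigenvalues₀_antitone ?_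
    rw [Fin.le_def]
    by_contra hlt
    refine hi ((Equiv.symm_apply_eq _).1 (Fin.ext ?_))
    simp only [← he] at hlt
    simp only
    omega
  nlinarith [mul_self_nonneg ((hA.eigenvectorBasis i).ofLp ⬝ᵥ y)]

/-- If `w` is an eigenvector for the largest eigenvalue `κ` then an upper bound for the second
eigenvalue bounds the quadratic form on the orthogonal complement of `w`. -/
lemma dotProduct_mulVec_le_of_orthogonal (hA : A.IsHermitian) (h : 1 < Fintype.card V)
    {η κ : ℝ} (hη : hA.eigenvalues₀ ⟨1, h⟩ ≤ η) {w : V → ℝ} (hw : w ≠ 0)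
    (hAw : A *ᵥ w = κ • w) (hκ : ∀ x, x ⬝ᵥ (A *ᵥ x) ≤ κ * (x ⬝ᵥ x))
    {x : V → ℝ} (hx : x ⬝ᵥ w = 0) : x ⬝ᵥ (A *ᵥ x) ≤ η * (x ⬝ᵥ x) := by
  have hnn : ∀ y : V → ℝ, 0 ≤ y ⬝ᵥ y := fun y =>
    Finset.sum_nonneg fun i _ => mul_self_nonneg (y i)
  have hww : 0 < w ⬝ᵥ w := (hnn w).lt_of_ne fun h0 => hw (dotProduct_self_eq_zero.1 h0.symm)
  -- The eigenvalue of `w` need not exceed `η`; if it does not, there is nothing to do.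
  rcases le_or_gt κ η with hle | hlt
  · exact (hκ x).trans (mul_le_mul_of_nonneg_right hle (hnn x))
  obtain ⟨b, hb⟩ := hA.exists_forall_dotProduct_mulVec_le_eigenvalues₀_one h
  have hb' : ∀ y, b ⬝ᵥ y = 0 → y ⬝ᵥ (A *ᵥ y) ≤ η * (y ⬝ᵥ y) := fun y hy =>
    (hb y hy).trans (mul_le_mul_of_nonneg_right hη (hnn y))
  have hbw : b ⬝ᵥ w ≠ 0 := by
    intro h0
    have := hb' w h0
    rw [hAw, dotProduct_smul, smul_eq_mul] at this
    nlinarith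
  have hAx : w ⬝ᵥ (A *ᵥ x) = 0 := by
    rw [hA.dotProduct_mulVec_comm, hAw, dotProduct_smul, hx, smul_zero]
  have hwx : w ⬝ᵥ x = 0 := by rw [dotProduct_comm, hx]
  -- The span of `x` and `w` contains a vector orthogonal to `b`, with a nonzero coefficient at `x`.
  have key := hb' ((b ⬝ᵥ w) • x - (b ⬝ᵥ x) • w) (by
    simp only [dotProduct_sub, dotProduct_smul, smul_eq_mul]; ring)
  simp only [mulVec_sub, mulVec_smul, dotProduct_sub, sub_dotProduct, dotProduct_smul,
    smul_dotProduct, smul_eq_mul, hAw, hAx, hx, hwx] at key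
  have h2 : 0 < (b ⬝ᵥ w) ^ 2 := by positivity
  have h3 : 0 ≤ (b ⬝ᵥ x) ^ 2 * ((κ - η) * (w ⬝ᵥ w)) :=
    mul_nonneg (sq_nonneg _) (mul_nonneg (sub_nonneg.2 hlt.le) hww.le)
  have h4 : (b ⬝ᵥ w) ^ 2 * (x ⬝ᵥ (A *ᵥ x)) ≤ (b ⬝ᵥ w) ^ 2 * (η * (x ⬝ᵥ x)) := by
    nlinarith only [key, h3]
  exact le_of_mul_le_mul_left h4 h2

end Matrix.IsHermitian

/-! ### Discrepancy of biregular bipartite graphs -/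

/-- The entries of the biadjacency matrix of a bipartite graph. -/
abbrev biadj {n m : ℕ} (G : SimpleGraph (Fin n ⊕ Fin m)) [DecidableRel G.Adj]
    (i : Fin n) (j : Fin m) : ℝ :=
  if G.Adj (Sum.inl i) (Sum.inr j) then 1 else 0

lemma sum_edgePositions {n m : ℕ} (G : SimpleGraph (Fin n ⊕ Fin m)) [DecidableRel G.Adj]
    (f : Fin n → Fin m → ℝ) :
    ∑ p ∈ edgePositions G, f p.1 p.2 = ∑ i, ∑ j, biadj G i j * f i j := by
  simp [edgePositions, Finset.sum_filter, Fintype.sum_prod_type]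

lemma sum_sub_mean_eq_zero {k : ℕ} (hk : 0 < k) (s : Fin k → ℝ) :
    ∑ i, (s i - (∑ i', s i') / k) = 0 := by
  have : (k : ℝ) ≠ 0 := by positivity
  simp only [Finset.sum_sub_distrib, Finset.sum_const, Finset.card_univ, Fintype.card_fin,
    nsmul_eq_mul]
  field_simp
  ring

lemma sum_sub_mean_sq_le {k : ℕ} (hk : 0 < k) {s : Fin k → ℝ} (hs : ∀ i, s i = 1 ∨ s i = -1) :
    ∑ i, (s i - (∑ i', s i') / k) * (s i - (∑ i', s i') / k) ≤ k := by
  have hk' : (k : ℝ) ≠ 0 := by positivity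
  set a := (∑ i', s i') / (k : ℝ) with ha
  have h : ∀ i, (s i - a) * (s i - a) = 1 - a * a - 2 * a * (s i - a) := by
    intro i
    rcases hs i with h | h <;> rw [h] <;> ring
  simp only [h, Finset.sum_sub_distrib, ← Finset.mul_sum]
  rw [← Finset.sum_sub_distrib, sum_sub_mean_eq_zero hk]
  simp only [Finset.sum_const, Finset.card_univ, Fintype.card_fin, nsmul_eq_mul]
  nlinarith [mul_nonneg (Nat.cast_nonneg (α := ℝ) k) (mul_self_nonneg a)]

namespace IsBiregularBipartite

variable {n m d₁ d₂ : ℕ} {G : SimpleGraph (Fin n ⊕ Fin m)} [DecidableRel G.Adj]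

lemma not_adj_inl (hG : IsBiregularBipartite G d₁ d₂) (i i' : Fin n) :
    ¬ G.Adj (Sum.inl i) (Sum.inl i') := by
  intro h
  rcases hG.1.mem_of_adj h with ⟨-, h2⟩ | ⟨h1, -⟩
  · simp at h2
  · simp at h1

lemma not_adj_inr (hG : IsBiregularBipartite G d₁ d₂) (j j' : Fin m) :
    ¬ G.Adj (Sum.inr j) (Sum.inr j') := by
  intro h
  rcases hG.1.mem_of_adj h with ⟨h1, -⟩ | ⟨-, h2⟩
  · simp at h1
  · simp at h2

lemma adjMatrix_mulVec_inl (hG : IsBiregularBipartite G d₁ d₂) (v : Fin n ⊕ Fin m → ℝ)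
    (i : Fin n) : (G.adjMatrix ℝ *ᵥ v) (Sum.inl i) = ∑ j, biadj G i j * v (Sum.inr j) := by
  simp [Matrix.mulVec, dotProduct, Fintype.sum_sum_type, SimpleGraph.adjMatrix_apply,
    hG.not_adj_inl]

lemma adjMatrix_mulVec_inr (hG : IsBiregularBipartite G d₁ d₂) (v : Fin n ⊕ Fin m → ℝ)
    (j : Fin m) : (G.adjMatrix ℝ *ᵥ v) (Sum.inr j) = ∑ i, biadj G i j * v (Sum.inl i) := by
  simp [Matrix.mulVec, dotProduct, Fintype.sum_sum_type, SimpleGraph.adjMatrix_apply,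
    hG.not_adj_inr, G.adj_comm (Sum.inr j)]

lemma sum_biadj_row (hG : IsBiregularBipartite G d₁ d₂) (i : Fin n) :
    ∑ j, biadj G i j = d₁ := by
  have h := hG.adjMatrix_mulVec_inl (Function.const _ 1) i
  rw [G.adjMatrix_mulVec_const_apply, hG.2.1 i] at h
  simpa using h.symm

lemma sum_biadj_col (hG : IsBiregularBipartite G d₁ d₂) (j : Fin m) :
    ∑ i, biadj G i j = d₂ := by
  have h := hG.adjMatrix_mulVec_inr (Function.const _ 1) j
  rw [G.adjMatrix_mulVec_const_apply, hG.2.2 j] at h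
  simpa using h.symm

lemma sum_biadj_mul_left (hG : IsBiregularBipartite G d₁ d₂) (a : Fin n → ℝ) :
    ∑ i, ∑ j, biadj G i j * a i = d₁ * ∑ i, a i := by
  rw [Finset.mul_sum]
  exact Finset.sum_congr rfl fun i _ => by rw [← Finset.sum_mul, hG.sum_biadj_row]

lemma sum_biadj_mul_right (hG : IsBiregularBipartite G d₁ d₂) (b : Fin m → ℝ) :
    ∑ i, ∑ j, biadj G i j * b j = d₂ * ∑ j, b j := by
  rw [Finset.sum_comm, Finset.mul_sum]
  exact Finset.sum_congr rfl fun j _ => by rw [← Finset.sum_mul, hG.sum_biadj_col]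

lemma card_edgePositions_eq_left (hG : IsBiregularBipartite G d₁ d₂) :
    ((edgePositions G).card : ℝ) = n * d₁ := by
  have h := sum_edgePositions G fun _ _ => 1
  have h' := hG.sum_biadj_mul_left fun _ => 1
  simp only [Finset.sum_const, nsmul_eq_mul, mul_one, Finset.card_univ, Fintype.card_fin] at h h'
  rw [h, h', mul_comm]

lemma card_edgePositions_eq_right (hG : IsBiregularBipartite G d₁ d₂) :
    ((edgePositions G).card : ℝ) = m * d₂ := by
  have h := sum_edgePositions G fun _ _ => 1
  have h' := hG.sum_biadj_mul_right fun _ => 1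
  simp only [Finset.sum_const, nsmul_eq_mul, mul_one, Finset.card_univ, Fintype.card_fin] at h h'
  rw [h, h', mul_comm]

lemma dotProduct_adjMatrix_mulVec (hG : IsBiregularBipartite G d₁ d₂) (a : Fin n → ℝ)
    (b : Fin m → ℝ) :
    Sum.elim a b ⬝ᵥ (G.adjMatrix ℝ *ᵥ Sum.elim a b) =
      2 * ∑ i, ∑ j, biadj G i j * (a i * b j) := by
  rw [dotProduct, Fintype.sum_sum_type]
  simp only [hG.adjMatrix_mulVec_inl, hG.adjMatrix_mulVec_inr, Sum.elim_inl, Sum.elim_inr,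
    Finset.mul_sum]
  rw [Finset.sum_comm (γ := Fin m), ← Finset.sum_add_distrib]
  refine Finset.sum_congr rfl fun i _ => ?_
  rw [← Finset.sum_add_distrib]
  exact Finset.sum_congr rfl fun j _ => by ring

lemma dotProduct_sumElim (a a' : Fin n → ℝ) (b b' : Fin m → ℝ) :
    Sum.elim a b ⬝ᵥ Sum.elim a' b' = ∑ i, a i * a' i + ∑ j, b j * b' j := by
  simp [dotProduct, Fintype.sum_sum_type]

/-- The vector with value `√d₁` on the first part and `√d₂` on the second is an eigenvector of the
adjacency matrix. -/
lemma adjMatrix_mulVec_sqrt (hG : IsBiregularBipartite G d₁ d₂) :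
    G.adjMatrix ℝ *ᵥ Sum.elim (fun _ => √(d₁ : ℝ)) (fun _ => √(d₂ : ℝ)) =
      √((d₁ : ℝ) * d₂) • Sum.elim (fun _ => √(d₁ : ℝ)) (fun _ => √(d₂ : ℝ)) := by
  have h1 := mul_self_sqrt (Nat.cast_nonneg (α := ℝ) d₁)
  have h2 := mul_self_sqrt (Nat.cast_nonneg (α := ℝ) d₂)
  have hκ := sqrt_mul (Nat.cast_nonneg (α := ℝ) d₁) d₂
  ext (i | j)
  · rw [hG.adjMatrix_mulVec_inl]
    simp only [Sum.elim_inr, Pi.smul_apply, Sum.elim_inl, smul_eq_mul]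
    rw [← Finset.sum_mul, hG.sum_biadj_row, hκ]
    linear_combination (-√(d₂ : ℝ)) * h1
  · rw [hG.adjMatrix_mulVec_inr]
    simp only [Sum.elim_inr, Pi.smul_apply, Sum.elim_inl, smul_eq_mul]
    rw [← Finset.sum_mul, hG.sum_biadj_col, hκ]
    linear_combination (-√(d₁ : ℝ)) * h2

/-- The largest eigenvalue of the adjacency matrix is at most `√(d₁ d₂)`. -/
lemma dotProduct_adjMatrix_mulVec_le (hG : IsBiregularBipartite G d₁ d₂) (h₁ : 0 < d₁)
    (h₂ : 0 < d₂) (x : Fin n ⊕ Fin m → ℝ) :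
    x ⬝ᵥ (G.adjMatrix ℝ *ᵥ x) ≤ √((d₁ : ℝ) * d₂) * (x ⬝ᵥ x) := by
  obtain ⟨a, b, rfl⟩ : ∃ (a : Fin n → ℝ) (b : Fin m → ℝ), x = Sum.elim a b :=
    ⟨x ∘ Sum.inl, x ∘ Sum.inr, (Sum.elim_comp_inl_inr x).symm⟩
  rw [hG.dotProduct_adjMatrix_mulVec, dotProduct_sumElim]
  set κ := √((d₁ : ℝ) * d₂)
  have hκ0 : 0 < κ := by positivity
  have hκ2 : κ * κ = d₁ * d₂ := mul_self_sqrt (by positivity)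
  have hκ := sqrt_mul (Nat.cast_nonneg (α := ℝ) d₁) d₂
  have h1 := mul_self_sqrt (Nat.cast_nonneg (α := ℝ) d₁)
  have h2 := mul_self_sqrt (Nat.cast_nonneg (α := ℝ) d₂)
  refine le_of_mul_le_mul_left ?_ hκ0
  have hedge : ∀ i j, biadj G i j * (2 * κ * (a i * b j)) ≤
      biadj G i j * (d₂ * (a i * a i)) + biadj G i j * (d₁ * (b j * b j)) := by
    intro i j
    rw [← mul_add]
    refine mul_le_mul_of_nonneg_left ?_ (by unfold biadj; split_ifs <;> norm_num)
    rw [show κ = √(d₁ : ℝ) * √(d₂ : ℝ) from hκ]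
    nlinarith [sq_nonneg (√(d₂ : ℝ) * a i - √(d₁ : ℝ) * b j)]
  have hsum := Finset.sum_le_sum fun i (_ : i ∈ Finset.univ) =>
    Finset.sum_le_sum fun j (_ : j ∈ Finset.univ) => hedge i j
  simp only [Finset.sum_add_distrib] at hsum
  rw [hG.sum_biadj_mul_left fun i => d₂ * (a i * a i),
    hG.sum_biadj_mul_right fun j => d₁ * (b j * b j), ← Finset.mul_sum, ← Finset.mul_sum] at hsum
  calc κ * (2 * ∑ i, ∑ j, biadj G i j * (a i * b j))
      = ∑ i, ∑ j, biadj G i j * (2 * κ * (a i * b j)) := by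
        simp only [Finset.mul_sum]
        exact Finset.sum_congr rfl fun i _ => Finset.sum_congr rfl fun j _ => by ring
    _ ≤ _ := hsum
    _ = κ * (κ * (∑ i, a i * a i + ∑ j, b j * b j)) := by
        rw [← mul_assoc κ κ, hκ2]; ring

/-- The edge set of a biregular bipartite graph with small second eigenvalue is close, in cut norm,
to a multiple of the complete edge set: a form of the expander mixing lemma. -/
lemma discrepancy_le (hG : IsBiregularBipartite G d₁ d₂) (hE : (edgePositions G).Nonempty)
    {η : ℝ} (hη₀ : 0 ≤ η) (hη : secondEigenvalue G ≤ η) {s : Fin n → ℝ} {t : Fin m → ℝ}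
    (hs : ∀ i, s i = 1 ∨ s i = -1) (ht : ∀ j, t j = 1 ∨ t j = -1) :
    ∑ i, ∑ j, (biadj G i j / (edgePositions G).card - 1 / ((n : ℝ) * m)) * (s i * t j) ≤
      η / √((d₁ : ℝ) * d₂) := by
  have hcard := hE.card_pos
  have e1 := hG.card_edgePositions_eq_left
  have e2 := hG.card_edgePositions_eq_right
  set e : ℝ := ((edgePositions G).card : ℝ)
  have he : 0 < e := Nat.cast_pos.2 hcard
  have hn : 0 < n := Nat.pos_of_ne_zero fun h => by simp [h] at e1; linarith
  have hm : 0 < m := Nat.pos_of_ne_zero fun h => by simp [h] at e2; linarith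
  have h₁ : 0 < d₁ := Nat.pos_of_ne_zero fun h => by simp [h] at e1; linarith
  have h₂ : 0 < d₂ := Nat.pos_of_ne_zero fun h => by simp [h] at e2; linarith
  have hV : 1 < Fintype.card (Fin n ⊕ Fin m) := by simp; omega
  rw [secondEigenvalue, dif_pos hV] at hη
  have hn' : (0 : ℝ) < n := Nat.cast_pos.2 hn
  have hm' : (0 : ℝ) < m := Nat.cast_pos.2 hm
  have h₁' : (0 : ℝ) < d₁ := Nat.cast_pos.2 h₁
  have h₂' : (0 : ℝ) < d₂ := Nat.cast_pos.2 h₂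
  set S := ∑ i, s i
  set T := ∑ j, t j
  set a : Fin n → ℝ := fun i => s i - S / n with ha
  set b : Fin m → ℝ := fun j => t j - T / m with hb
  have ha0 : ∑ i, a i = 0 := sum_sub_mean_eq_zero hn s
  have hb0 : ∑ j, b j = 0 := sum_sub_mean_eq_zero hm t
  have ha2 : ∑ i, a i * a i ≤ n := sum_sub_mean_sq_le hn hs
  have hb2 : ∑ j, b j * b j ≤ m := sum_sub_mean_sq_le hm ht
  -- The two parts are weighted so that the vector has mass `n * m` on each of them.
  have hq := (adjMatrix_isHermitian_real G).dotProduct_mulVec_le_of_orthogonal hV hη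
    (w := Sum.elim (fun _ => √(d₁ : ℝ)) (fun _ => √(d₂ : ℝ)))
    (fun h0 => (sqrt_pos.2 h₁').ne' (congrFun h0 (Sum.inl ⟨0, hn⟩)))
    hG.adjMatrix_mulVec_sqrt (hG.dotProduct_adjMatrix_mulVec_le h₁ h₂)
    (x := Sum.elim (fun i => √(m : ℝ) * a i) (fun j => √(n : ℝ) * b j))
    (by rw [dotProduct_sumElim, ← Finset.sum_mul, ← Finset.sum_mul, ← Finset.mul_sum,
          ← Finset.mul_sum, ha0, hb0]; ring)
  rw [hG.dotProduct_adjMatrix_mulVec, dotProduct_sumElim] at hq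
  have hmm := mul_self_sqrt hm'.le
  have hnn := mul_self_sqrt hn'.le
  have hB : ∑ i, ∑ j, biadj G i j * (√(m : ℝ) * a i * (√(n : ℝ) * b j)) =
      √((n : ℝ) * m) * ∑ i, ∑ j, biadj G i j * (a i * b j) := by
    rw [sqrt_mul hn'.le]
    simp only [Finset.mul_sum]
    exact Finset.sum_congr rfl fun i _ => Finset.sum_congr rfl fun j _ => by ring
  have hA : ∑ i, √(m : ℝ) * a i * (√(m : ℝ) * a i) ≤ m * n := by
    calc _ = m * ∑ i, a i * a i := by
          rw [Finset.mul_sum]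
          exact Finset.sum_congr rfl fun i _ => by linear_combination (a i * a i) * hmm
      _ ≤ m * n := by gcongr
  have hA' : ∑ j, √(n : ℝ) * b j * (√(n : ℝ) * b j) ≤ n * m := by
    calc _ = n * ∑ j, b j * b j := by
          rw [Finset.mul_sum]
          exact Finset.sum_congr rfl fun i _ => by linear_combination (b i * b i) * hnn
      _ ≤ n * m := by gcongr
  have hnm : 0 < √((n : ℝ) * m) := by positivity
  have hnm2 : √((n : ℝ) * m) * √((n : ℝ) * m) = n * m := mul_self_sqrt (by positivity)
  have hab : ∑ i, ∑ j, biadj G i j * (a i * b j) ≤ η * √((n : ℝ) * m) := by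
    refine le_of_mul_le_mul_left ?_ hnm
    rw [← hB]
    nlinarith [mul_le_mul_of_nonneg_left (add_le_add hA hA') hη₀]
  -- Removing the means changes the form by the form of the complete graph.
  have hexp : ∑ i, ∑ j, biadj G i j * (a i * b j) =
      ∑ i, ∑ j, biadj G i j * (s i * t j) - e / (n * m) * (S * T) := by
    have hpt : ∀ i j, biadj G i j * (a i * b j) = biadj G i j * (s i * t j)
        - T / m * (biadj G i j * a i) - S / n * (biadj G i j * b j)
        - S / n * (T / m) * (biadj G i j * 1) := fun i j => by
      simp only [ha, hb]; ring
    have hcount : ∑ i, ∑ j, biadj G i j * 1 = e := by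
      rw [hG.sum_biadj_mul_left fun _ => 1, e1]; simp; ring
    simp only [hpt, Finset.sum_sub_distrib, ← Finset.mul_sum]
    rw [hG.sum_biadj_mul_left a, hG.sum_biadj_mul_right b, ha0, hb0, hcount]
    field_simp
    ring
  have hST : ∑ i, s i * ∑ j, t j = S * T := (Finset.sum_mul _ _ _).symm
  have hgoal : ∑ i, ∑ j, (biadj G i j / e - 1 / ((n : ℝ) * m)) * (s i * t j) =
      (∑ i, ∑ j, biadj G i j * (a i * b j)) / e := by
    have hpt : ∀ i j, (biadj G i j / e - 1 / ((n : ℝ) * m)) * (s i * t j) =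
        e⁻¹ * (biadj G i j * (s i * t j)) - 1 / ((n : ℝ) * m) * (s i * t j) := fun i j => by ring
    simp only [hpt, Finset.sum_sub_distrib, ← Finset.mul_sum]
    rw [hexp, hST]
    field_simp
  have hesq : e = √((n : ℝ) * m) * √((d₁ : ℝ) * d₂) := by
    rw [← sqrt_mul (by positivity), ← sqrt_mul_self he.le]
    congr 1
    nth_rewrite 1 [e1]
    rw [e2]; ring
  rw [hgoal, hesq, div_le_div_iff₀ (by positivity) (by positivity)]
  nlinarith [mul_le_mul_of_nonneg_right hab (sqrt_nonneg ((d₁ : ℝ) * d₂))]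

end IsBiregularBipartite

/-! ### Grothendieck's inequality for vectors of bounded norm -/

lemma EuclideanSpace.real_inner_eq_sum {ι : Type*} [Fintype ι] (x y : EuclideanSpace ℝ ι) :
    inner ℝ x y = ∑ a, x a * y a := by
  simp [PiLp.inner_apply, mul_comm]

/-- Grothendieck's inequality for vectors that need not be unit vectors: they become unit vectors
with the same scalar products when a further coordinate is added to each, one for the vectors `x i`
and another one for the vectors `y j`. -/
lemma GrothendieckInequality.of_norm_sq_le {K : ℝ} (hK : GrothendieckInequality K) {k l : ℕ}
    (A : Matrix (Fin k) (Fin l) ℝ) {C : ℝ}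
    (hC : ∀ (s : Fin k → ℝ) (t : Fin l → ℝ), (∀ i, s i = 1 ∨ s i = -1) →
      (∀ j, t j = 1 ∨ t j = -1) → |∑ i, ∑ j, A i j * (s i * t j)| ≤ C)
    {ι : Type*} [Fintype ι] {R : ℝ} (hR : 0 < R) (x : Fin k → EuclideanSpace ℝ ι)
    (y : Fin l → EuclideanSpace ℝ ι) (hx : ∀ i, ‖x i‖ ^ 2 ≤ R) (hy : ∀ j, ‖y j‖ ^ 2 ≤ R) :
    |∑ i, ∑ j, A i j * inner ℝ (x i) (y j)| ≤ K * C * R := by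
  let e : ι ⊕ Fin 2 ≃ Fin (Fintype.card (ι ⊕ Fin 2)) := Fintype.equivFin _
  let f := LinearIsometryEquiv.piLpCongrLeft 2 ℝ ℝ e
  let x' : Fin k → EuclideanSpace ℝ (ι ⊕ Fin 2) := fun i =>
    WithLp.toLp 2 (Sum.elim (fun a => x i a / √R) ![√(1 - ‖x i‖ ^ 2 / R), 0])
  let y' : Fin l → EuclideanSpace ℝ (ι ⊕ Fin 2) := fun j =>
    WithLp.toLp 2 (Sum.elim (fun a => y j a / √R) ![0, √(1 - ‖y j‖ ^ 2 / R)])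
  have hRR : √R * √R = R := mul_self_sqrt hR.le
  have hsum : ∀ u v : EuclideanSpace ℝ ι, ∑ a, u a / √R * (v a / √R) = inner ℝ u v / R := by
    intro u v
    rw [EuclideanSpace.real_inner_eq_sum, Finset.sum_div]
    refine Finset.sum_congr rfl fun a _ => ?_
    rw [div_mul_div_comm, hRR]
  have hnorm : ∀ u : EuclideanSpace ℝ ι, ‖u‖ ^ 2 ≤ R →
      inner ℝ u u / R + √(1 - ‖u‖ ^ 2 / R) * √(1 - ‖u‖ ^ 2 / R) = 1 := by
    intro u hu
    rw [mul_self_sqrt (sub_nonneg.2 ((div_le_one hR).2 hu)), real_inner_self_eq_norm_sq]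
    ring
  have hx' : ∀ i, ‖f (x' i)‖ = 1 := by
    intro i
    rw [LinearIsometryEquiv.norm_map, ← sq_eq_sq₀ (norm_nonneg _) zero_le_one,
      ← real_inner_self_eq_norm_sq, EuclideanSpace.real_inner_eq_sum, Fintype.sum_sum_type]
    simp only [x', Sum.elim_inl, Sum.elim_inr, hsum, Fin.sum_univ_two]
    simpa using hnorm _ (hx i)
  have hy' : ∀ j, ‖f (y' j)‖ = 1 := by
    intro j
    rw [LinearIsometryEquiv.norm_map, ← sq_eq_sq₀ (norm_nonneg _) zero_le_one,
      ← real_inner_self_eq_norm_sq, EuclideanSpace.real_inner_eq_sum, Fintype.sum_sum_type]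
    simp only [y', Sum.elim_inl, Sum.elim_inr, hsum, Fin.sum_univ_two]
    simpa using hnorm _ (hy j)
  have hxy : ∀ i j, inner ℝ (f (x' i)) (f (y' j)) = inner ℝ (x i) (y j) / R := by
    intro i j
    rw [LinearIsometryEquiv.inner_map_map, EuclideanSpace.real_inner_eq_sum, Fintype.sum_sum_type]
    simp only [x', y', Sum.elim_inl, Sum.elim_inr, hsum, Fin.sum_univ_two]
    simp
  have h := hK k l A C hC _ (fun i => f (x' i)) (fun j => f (y' j)) hx' hy'
  simp only [hxy] at h
  rw [← div_le_iff₀ hR]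
  refine le_trans (le_of_eq ?_) h
  rw [← abs_of_pos hR, ← abs_div, abs_of_pos hR, Finset.sum_div]
  congr 1
  refine Finset.sum_congr rfl fun i _ => ?_
  rw [Finset.sum_div]
  exact Finset.sum_congr rfl fun j _ => by ring

/-! ### Factorizations and the norm `γ₂` -/

lemma maxRowNorm_nonneg {n k : ℕ} (U : Matrix (Fin n) (Fin k) ℝ) : 0 ≤ maxRowNorm U :=
  iSup_nonneg fun _ => sqrt_nonneg _

lemma sum_sq_le_maxRowNorm_sq {n k : ℕ} (U : Matrix (Fin n) (Fin k) ℝ) (i : Fin n) :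
    ∑ j, U i j ^ 2 ≤ maxRowNorm U ^ 2 :=
  sqrt_le_left (maxRowNorm_nonneg U) |>.1 (le_ciSup (f := fun i => √(∑ j, U i j ^ 2))
    (Finite.bddAbove_range _) i)

lemma gammaTwo_nonneg {n m : ℕ} (X : Matrix (Fin n) (Fin m) ℝ) : 0 ≤ gammaTwo X := by
  refine sInf_nonneg ?_
  rintro _ ⟨k, U, V, -, rfl⟩
  exact mul_nonneg (maxRowNorm_nonneg U) (maxRowNorm_nonneg V)

/-- A matrix with `γ₂`-norm less than `R` is a matrix of scalar products of vectors whose squared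
norms are at most `R`: the two factors can be rescaled to have equal row norms. -/
lemma exists_inner_of_gammaTwo_lt {n m : ℕ} {X : Matrix (Fin n) (Fin m) ℝ} {R : ℝ}
    (h : gammaTwo X < R) :
    ∃ (k : ℕ) (u : Fin n → EuclideanSpace ℝ (Fin k)) (v : Fin m → EuclideanSpace ℝ (Fin k)),
      (∀ i j, X i j = inner ℝ (u i) (v j)) ∧ (∀ i, ‖u i‖ ^ 2 ≤ R) ∧ ∀ j, ‖v j‖ ^ 2 ≤ R := by
  have hR : 0 < R := (gammaTwo_nonneg X).trans_lt h
  obtain ⟨_, ⟨k, U, V, hUV, rfl⟩, hlt⟩ := exists_lt_of_csInf_lt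
    (by exact ⟨_, m, X, 1, by simp, rfl⟩) h
  have hX : ∀ i j, X i j = ∑ a, U i a * V j a := fun i j => by
    rw [← hUV, Matrix.mul_apply]; simp
  have hU := sum_sq_le_maxRowNorm_sq U
  have hV := sum_sq_le_maxRowNorm_sq V
  have hr0 := maxRowNorm_nonneg U
  have hs0 := maxRowNorm_nonneg V
  set r := maxRowNorm U
  set s := maxRowNorm V
  rcases eq_or_ne (r * s) 0 with h0 | h0
  · -- One of the factors vanishes, and so does `X`.
    refine ⟨0, fun _ => 0, fun _ => 0, fun i j => ?_, by simp [hR.le], by simp [hR.le]⟩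
    have hcs := Finset.sum_mul_sq_le_sq_mul_sq Finset.univ (U i) (V j)
    have : (∑ a, U i a * V j a) ^ 2 ≤ 0 := by
      calc _ ≤ _ := hcs
        _ ≤ r ^ 2 * s ^ 2 := mul_le_mul (hU i) (hV j)
            (Finset.sum_nonneg fun _ _ => sq_nonneg _) (sq_nonneg _)
        _ = 0 := by rw [← mul_pow, h0]; simp
    rw [hX, pow_eq_zero_iff two_ne_zero |>.1 (le_antisymm this (sq_nonneg _))]
    simp
  have hr : 0 < r := hr0.lt_of_ne fun h => h0 (by rw [← h, zero_mul])
  have hs : 0 < s := hs0.lt_of_ne fun h => h0 (by rw [← h, mul_zero])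
  have hrs : √(s / r) * √(r / s) = 1 := by
    rw [← sqrt_mul (by positivity)]
    field_simp
    simp
  refine ⟨k, fun i => √(s / r) • WithLp.toLp 2 (U i), fun j => √(r / s) • WithLp.toLp 2 (V j),
    fun i j => ?_, fun i => ?_, fun j => ?_⟩
  · rw [real_inner_smul_left, real_inner_smul_right, ← mul_assoc, hrs, one_mul, hX,
      EuclideanSpace.real_inner_eq_sum]
  · rw [norm_smul, mul_pow, EuclideanSpace.real_norm_sq_eq, norm_eq_abs, sq_abs,
      sq_sqrt (by positivity)]
    calc s / r * ∑ a, U i a ^ 2 ≤ s / r * r ^ 2 := by gcongr; exact hU i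
      _ = r * s := by field_simp
      _ ≤ R := hlt.le
  · rw [norm_smul, mul_pow, EuclideanSpace.real_norm_sq_eq, norm_eq_abs, sq_abs,
      sq_sqrt (by positivity)]
    calc r / s * ∑ a, V j a ^ 2 ≤ r / s * s ^ 2 := by gcongr; exact hV j
      _ = r * s := by field_simp
      _ ≤ R := hlt.le

/-- A difference of matrices of `γ₂`-norm less than `R` is a matrix of scalar products of vectors
of squared norm at most `2 * R`. -/
lemma exists_inner_sub_of_gammaTwo_lt {n m : ℕ} {X Y : Matrix (Fin n) (Fin m) ℝ} {R : ℝ}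
    (hX : gammaTwo X < R) (hY : gammaTwo Y < R) :
    ∃ (k l : ℕ) (u : Fin n → EuclideanSpace ℝ (Fin k ⊕ Fin l))
      (v : Fin m → EuclideanSpace ℝ (Fin k ⊕ Fin l)),
      (∀ i j, (X - Y) i j = inner ℝ (u i) (v j)) ∧
        (∀ i, ‖u i‖ ^ 2 ≤ 2 * R) ∧ ∀ j, ‖v j‖ ^ 2 ≤ 2 * R := by
  obtain ⟨k, u, v, huv, hu, hv⟩ := exists_inner_of_gammaTwo_lt hX
  obtain ⟨l, u', v', huv', hu', hv'⟩ := exists_inner_of_gammaTwo_lt hY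
  refine ⟨k, l, fun i => WithLp.toLp 2 (Sum.elim (u i) (u' i)),
    fun j => WithLp.toLp 2 (Sum.elim (v j) (-v' j)), fun i j => ?_, fun i => ?_, fun j => ?_⟩
  · rw [Matrix.sub_apply, huv, huv', EuclideanSpace.real_inner_eq_sum,
      EuclideanSpace.real_inner_eq_sum, EuclideanSpace.real_inner_eq_sum, Fintype.sum_sum_type]
    simp [sub_eq_add_neg]
  · have h := add_le_add (hu i) (hu' i)
    rw [EuclideanSpace.real_norm_sq_eq, EuclideanSpace.real_norm_sq_eq] at h
    rw [EuclideanSpace.real_norm_sq_eq, Fintype.sum_sum_type]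
    simp only [Sum.elim_inl, Sum.elim_inr]
    linarith
  · have h := add_le_add (hv j) (hv' j)
    rw [EuclideanSpace.real_norm_sq_eq, EuclideanSpace.real_norm_sq_eq] at h
    rw [EuclideanSpace.real_norm_sq_eq, Fintype.sum_sum_type]
    simp only [Sum.elim_inl, Sum.elim_inr, Pi.neg_apply, neg_sq]
    linarith

/-! ### Comparison of the means over all positions and over the edges -/

/-- The tensor square `x ⊗ x` of a vector, in coordinates. -/
noncomputable def tensorSquare {ι : Type*} (x : EuclideanSpace ℝ ι) : EuclideanSpace ℝ (ι × ι) :=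
  WithLp.toLp 2 fun p => x p.1 * x p.2

lemma inner_tensorSquare {ι : Type*} [Fintype ι] (x y : EuclideanSpace ℝ ι) :
    inner ℝ (tensorSquare x) (tensorSquare y) = inner ℝ x y ^ 2 := by
  simp only [EuclideanSpace.real_inner_eq_sum, tensorSquare]
  rw [sq, Finset.sum_mul_sum, Fintype.sum_prod_type]
  exact Finset.sum_congr rfl fun a _ => Finset.sum_congr rfl fun b _ => by ring

lemma norm_tensorSquare_sq {ι : Type*} [Fintype ι] (x : EuclideanSpace ℝ ι) :
    ‖tensorSquare x‖ ^ 2 = (‖x‖ ^ 2) ^ 2 := by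
  rw [← real_inner_self_eq_norm_sq, inner_tensorSquare, real_inner_self_eq_norm_sq]

lemma Matrix.frobenius_norm_sq {n m : ℕ} (X : Matrix (Fin n) (Fin m) ℝ) :
    ‖X‖ ^ 2 = ∑ i, ∑ j, X i j ^ 2 := by
  rw [Matrix.frobenius_norm_def, ← sqrt_eq_rpow, sq_sqrt (by positivity)]
  simp

/-- The mean of the squared entries of a matrix of scalar products is controlled by their mean over
the edges of the graph. Grothendieck's inequality is applied to the squared entries, which are the
scalar products of the tensor squares. -/
lemma IsBiregularBipartite.frobenius_norm_sq_le {n m d₁ d₂ : ℕ} {G : SimpleGraph (Fin n ⊕ Fin m)}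
    [DecidableRel G.Adj] (hG : IsBiregularBipartite G d₁ d₂) (hE : (edgePositions G).Nonempty)
    {η : ℝ} (hη₀ : 0 ≤ η) (hη : secondEigenvalue G ≤ η) {X : Matrix (Fin n) (Fin m) ℝ}
    {ι : Type*} [Fintype ι] {R : ℝ} (hR : 0 < R) (u : Fin n → EuclideanSpace ℝ ι)
    (v : Fin m → EuclideanSpace ℝ ι) (hX : ∀ i j, X i j = inner ℝ (u i) (v j))
    (hu : ∀ i, ‖u i‖ ^ 2 ≤ R) (hv : ∀ j, ‖v j‖ ^ 2 ≤ R) :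
    1 / ((n : ℝ) * m) * ‖X‖ ^ 2 ≤
      grothendieckConstant * (η / √((d₁ : ℝ) * d₂)) * R ^ 2 +
        meanSquareOn (edgePositions G) X := by
  let A : Matrix (Fin n) (Fin m) ℝ := Matrix.of fun i j =>
    biadj G i j / (edgePositions G).card - 1 / ((n : ℝ) * m)
  have hA : ∀ (s : Fin n → ℝ) (t : Fin m → ℝ), (∀ i, s i = 1 ∨ s i = -1) →
      (∀ j, t j = 1 ∨ t j = -1) →
      |∑ i, ∑ j, A i j * (s i * t j)| ≤ η / √((d₁ : ℝ) * d₂) := by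
    intro s t hs ht
    refine abs_le'.2 ⟨hG.discrepancy_le hE hη₀ hη hs ht, ?_⟩
    have h := hG.discrepancy_le hE hη₀ hη (s := -s) (fun i => by
      rcases hs i with h | h <;> simp [h]) ht
    refine le_trans (le_of_eq ?_) h
    simp only [A, Matrix.of_apply, Pi.neg_apply, neg_mul, mul_neg, Finset.sum_neg_distrib]
  have hgr := grothendieckInequality_grothendieckConstant.of_norm_sq_le A hA (pow_pos hR 2)
    (fun i => tensorSquare (u i)) (fun j => tensorSquare (v j))
    (fun i => by rw [norm_tensorSquare_sq]; gcongr; exact hu i)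
    (fun j => by rw [norm_tensorSquare_sq]; gcongr; exact hv j)
  simp only [inner_tensorSquare, ← hX] at hgr
  have hsum : ∑ i, ∑ j, A i j * X i j ^ 2 =
      meanSquareOn (edgePositions G) X - 1 / ((n : ℝ) * m) * ‖X‖ ^ 2 := by
    rw [Matrix.frobenius_norm_sq, meanSquareOn, sum_edgePositions G fun i j => X i j ^ 2]
    simp only [Finset.mul_sum, ← Finset.sum_sub_distrib, A, Matrix.of_apply]
    exact Finset.sum_congr rfl fun i _ => Finset.sum_congr rfl fun j _ => by ring
  rw [hsum] at hgr
  linarith [(abs_le.1 hgr).1]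

lemma meanSquareOn_le_of_add {n m : ℕ} {E : Finset (Fin n × Fin m)}
    {X P Q : Matrix (Fin n) (Fin m) ℝ} {c : ℝ} (hX : ∀ p ∈ E, X p.1 p.2 = P p.1 p.2 + Q p.1 p.2)
    (hP : meanSquareOn E P ≤ c) (hQ : meanSquareOn E Q ≤ c) : meanSquareOn E X ≤ 4 * c := by
  have h : meanSquareOn E X ≤ 2 * meanSquareOn E P + 2 * meanSquareOn E Q := by
    unfold meanSquareOn
    rw [mul_left_comm, mul_left_comm 2, ← mul_add]
    refine mul_le_mul_of_nonneg_left ?_ (by positivity)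
    rw [Finset.mul_sum, Finset.mul_sum, ← Finset.sum_add_distrib]
    refine Finset.sum_le_sum fun p hp => ?_
    rw [hX p hp]
    nlinarith [sq_nonneg (P p.1 p.2 - Q p.1 p.2)]
  linarith

theorem mainTheorem5 {n m d₁ d₂ : ℕ} (G : SimpleGraph (Fin n ⊕ Fin m)) [DecidableRel G.Adj]
    (hG : IsBiregularBipartite G d₁ d₂) (hE : (edgePositions G).Nonempty)
    (η : ℝ) (hη₀ : 0 ≤ η) (hη : secondEigenvalue G ≤ η)
    (Y ε Z : Matrix (Fin n) (Fin m) ℝ) (δ : ℝ)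
    (hZ : ∀ p ∈ edgePositions G, Z p.1 p.2 = Y p.1 p.2 + ε p.1 p.2)
    (hε : meanSquareOn (edgePositions G) ε ≤ δ ^ 2)
    (Yhat : Matrix (Fin n) (Fin m) ℝ)
    (hYhat : IsNoisyCompletion (edgePositions G) Z δ Yhat) :
    4 * grothendieckConstant ≤ 7.13 ∧
      (1 / ((n : ℝ) * (m : ℝ))) * ‖Yhat - Y‖ ^ 2 ≤
        4 * grothendieckConstant * gammaTwo Y ^ 2 * (η / Real.sqrt ((d₁ : ℝ) * (d₂ : ℝ))) +
          4 * δ ^ 2 := by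
  refine ⟨four_mul_grothendieckConstant_le, ?_⟩
  have hmean : meanSquareOn (edgePositions G) (Yhat - Y) ≤ 4 * δ ^ 2 :=
    meanSquareOn_le_of_add (P := Yhat - Z) (Q := ε)
      (fun p hp => by simp only [Matrix.sub_apply, hZ p hp]; ring) hYhat.1 hε
  -- The true matrix is feasible.
  have hfeas : meanSquareOn (edgePositions G) (Y - Z) ≤ δ ^ 2 := by
    refine le_trans (le_of_eq ?_) hε
    unfold meanSquareOn
    congr 1
    refine Finset.sum_congr rfl fun p hp => ?_
    rw [Matrix.sub_apply, hZ p hp]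
    ring
  have hγ : gammaTwo Yhat ≤ gammaTwo Y := hYhat.2 Y hfeas
  have hbound : ∀ R, gammaTwo Y < R → 1 / ((n : ℝ) * m) * ‖Yhat - Y‖ ^ 2 ≤
      4 * grothendieckConstant * R ^ 2 * (η / √((d₁ : ℝ) * d₂)) + 4 * δ ^ 2 := by
    intro R hR
    obtain ⟨k, l, u, v, huv, hu, hv⟩ := exists_inner_sub_of_gammaTwo_lt (hγ.trans_lt hR) hR
    have hR0 : 0 < 2 * R := by linarith [gammaTwo_nonneg Y]
    have h := hG.frobenius_norm_sq_le hE hη₀ hη hR0 u v huv hu hv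
    refine h.trans ?_
    linarith
  -- Let `R` decrease to `gammaTwo Y`; this avoids the attainment of the infimum.
  refine ge_of_tendsto (x := nhdsWithin (gammaTwo Y) (Ioi (gammaTwo Y)))
    (f := fun R => 4 * grothendieckConstant * R ^ 2 * (η / √((d₁ : ℝ) * d₂)) + 4 * δ ^ 2) ?_ ?_
  · refine Filter.Tendsto.mono_left (Continuous.tendsto ?_ _) nhdsWithin_le_nhds
    fun_prop
  · filter_upwards [self_mem_nhdsWithin] with R hR using hbound R hR
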